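/- A two-stage scheme for $M$ messages, of length $n$ and with one use of noiseless feedback at time $n_1$ (where $1<n_1<n$), consists of two maps $f:[M]\to\{0,1\}^{n_1}$ and $g:[M]\times\{0,1\}^{n_1}\to\{0,1\}^{n-n_1}$. To send a message $m$, one first transmits $f(m)$ over the Z-channel. Once its output $y_1\in\{0,1\}^{n_1}$ is known, one transmits $g(m,y_1)$, with output $y_2\in\{0,1\}^{n-n_1}$. An adversary controls the channel and may change transmitted ones to zeros, but never zeros to ones; each such change is an error. The scheme corrects $t$ errors if some decoder recovers $m$ from $(y_1,y_2)$ for every message $m$ and every output $(y_1,y_2)$ that arises from at most $t$ errors in total over the two stages. Let $M_Z^{(2)}(n,t)$ be the largest $M$ for which a two-stage scheme of length $n$ that corrects $t$ errors exists, where $n_1$ may be chosen depending on $n$ and $t$. For $\tau\ge 0$ let $$R_Z^{(2)}(\tau):=\limsup_{n\to\infty}\frac{\log_2 M_Z^{(2)}(n,\lfloor\tau n\rfloor)}{n}.$$ **Theorem.** The maximum $\tau_{\max}:=\max_{0<\omega<1}\frac{\omega+\omega^3}{1+4\omega^3}$ is attained, and $\tau_{\max}\approx 0.44$ (namely $|\tau_{\max}-0.44|<0.005$).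 Moreover, $R_Z^{(2)}(\tau)>0$ for all $0\le\tau<\tau_{\max}$, and $R_Z^{(2)}(\tau)=0$ for all $\tau>\tau_{\max}$. -/

import Mathlib

open Filter

namespace ZChannel

/-- Binary words of length `n`. -/
abbrev Word (n : ℕ) : Type := Fin n → Bool

/-- `Δ(x, y)`: the number of positions `i` with `x i = 1` and `y i = 0`. -/
def numErrors {n : ℕ} (x y : Word n) : ℕ :=
  (Finset.univ.filter fun i => x i = true ∧ y i = false).card

/-- The Z-channel may turn the input `x` into `y`: a `1` is received only where a `1` was sent. -/
def CanReceive {n : ℕ} (x y : Word n) : Prop :=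
  ∀ i, y i = true → x i = true

/-- A two-stage encoder for `M` messages with `n₁` channel uses before and `n₂` channel uses
after the single use of the noiseless feedback. -/
structure TwoStageEncoder (n₁ n₂ M : ℕ) where
  /-- The word sent in the first stage. -/
  first : Fin M → Word n₁
  /-- The word sent in the second stage, given the received output of the first stage. -/
  second : Fin M → Word n₁ → Word n₂

/-- The pair of outputs `(y₁, y₂)` can be received when the message `m` is sent and the adversary
makes at most `t` errors in total. -/
def TwoStageEncoder.IsOutput {n₁ n₂ M : ℕ} (E : TwoStageEncoder n₁ n₂ M) (t : ℕ) (m : Fin M)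
    (y₁ : Word n₁) (y₂ : Word n₂) : Prop :=
  CanReceive (E.first m) y₁ ∧ CanReceive (E.second m y₁) y₂ ∧
    numErrors (E.first m) y₁ + numErrors (E.second m y₁) y₂ ≤ t

/-- Some decoder recovers the message from every output of an adversary who makes at most `t`
errors in total. -/
def TwoStageEncoder.Corrects {n₁ n₂ M : ℕ} (E : TwoStageEncoder n₁ n₂ M) (t : ℕ) : Prop :=
  ∃ dec : Word n₁ → Word n₂ → Fin M,
    ∀ (m : Fin M) (y₁ : Word n₁) (y₂ : Word n₂), E.IsOutput t m y₁ y₂ → dec y₁ y₂ = m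

/-- `M` messages can be transmitted in `n` channel uses with at most `t` errors, for a suitable
feedback moment `n₁` with `1 < n₁ < n`, which is fixed beforehand. -/
def Transmittable (n t M : ℕ) : Prop :=
  ∃ n₁ n₂ : ℕ, 1 < n₁ ∧ 0 < n₂ ∧ n₁ + n₂ = n ∧
    ∃ E : TwoStageEncoder n₁ n₂ M, E.Corrects t

/-- The maximum number of messages that two-stage coding can transmit in `n` channel uses with at
most `t` errors. -/
noncomputable def maxMessages (n t : ℕ) : ℕ := sSup {M : ℕ | Transmittable n t M}

lemma Transmittable.le_two_pow {n t M : ℕ} (h : Transmittable n t M) : M ≤ 2 ^ n := by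
  obtain ⟨n₁, n₂, -, -, rfl, E, dec, hdec⟩ := h
  have hself : ∀ m, E.IsOutput t m (E.first m) (E.second m (E.first m)) := by
    intro m
    refine ⟨fun _ hi => hi, fun _ hi => hi, ?_⟩
    have hz : ∀ {k : ℕ} (x : Word k), numErrors x x = 0 := by
      intro k x
      simp [numErrors]
    simp [hz]
  have hinj : Function.Injective
      (fun m => ((E.first m, E.second m (E.first m)) : Word n₁ × Word n₂)) := by
    intro a b hab
    simp only [Prod.mk.injEq] at hab
    have ha := hdec a _ _ (hself a)
    have hb := hdec b _ _ (hself b)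
    rw [hab.1] at ha
    rw [← hb, ← ha, ← hab.2, hab.1]
  have := Fintype.card_le_of_injective _ hinj
  simpa [pow_add] using this

lemma transmittable_one {n : ℕ} (hn : 3 ≤ n) (t : ℕ) : Transmittable n t 1 :=
  ⟨2, n - 2, by omega, by omega, by omega,
    ⟨fun _ _ => false, fun _ _ _ => false⟩, fun _ _ => 0, fun _ _ _ _ => Subsingleton.elim _ _⟩

/-- The supremum in the definition of `maxMessages` is a maximum. -/
lemma isGreatest_maxMessages {n : ℕ} (hn : 3 ≤ n) (t : ℕ) :
    IsGreatest {M : ℕ | Transmittable n t M} (maxMessages n t) := by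
  have hb : BddAbove {M : ℕ | Transmittable n t M} := ⟨2 ^ n, fun _ h => h.le_two_pow⟩
  exact ⟨Nat.sSup_mem ⟨1, transmittable_one hn t⟩ hb, fun _ h => le_csSup hb h⟩

/-- The maximal asymptotic rate of two-stage error-correcting codes for the Z-channel, for a
fraction `τ ≥ 0` of errors. The sequence takes values in `[0, 1]`. -/
noncomputable def rate (τ : ℝ) : ℝ :=
  limsup (fun n : ℕ => Real.logb 2 (maxMessages n ⌊τ * n⌋₊ : ℝ) / n) atTop

/-- The function `(ω + ω³) / (1 + 4 ω³)`. -/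
noncomputable def plotkinFun (ω : ℝ) : ℝ := (ω + ω ^ 3) / (1 + 4 * ω ^ 3)

/-- The maximum of `plotkinFun` over `0 < ω < 1`. -/
noncomputable def tauMax : ℝ := sSup (plotkinFun '' Set.Ioo 0 1)

end ZChannel

namespace ZChannel

/-! ### The function `plotkinFun` -/

/-! Two messages are confusable exactly when the adversary can bring both to a common first output
`y` and then bring both second-stage words to their meet within the total budget (`lt_or_lt`,
`corrects_of_lt_or_lt`). So after the first stage only the list of messages compatible with `y`
matters.

Converse: among sufficiently many messages, pigeonhole leaves many first words of nearly equal
weight `ω n₁`. The adversary can erase the first stage, at cost `ω n₁`, and use the Plotkin bound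
`n₂ / 4` in the second. Or he can reduce three messages to their common support, at cost about `(ω -
ω ^ 3) n₁` by the power mean inequality, and confuse two of the three for `n₂ / 2` more. The two
costs agree when `n₂ = 4 ω ^ 3 n₁`, and their common value per channel use is then `plotkinFun ω`;
for every other split one of the costs is at most `tauMax (n₁ + n₂)` (`le_tauMax_of_le_of_le`).
Beyond `tauMax` the number of messages therefore stays bounded.

Achievability: take the maximiser `w` and the balanced split. In a random first-stage code of
density `w`, a list of `L` compatible messages forces about `(w - w ^ L) n₁` errors on each of them.
The remaining errors are handled by an explicit small code if `L` is bounded (`exists_hasCode`), and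
by a random code with relative distance near `1 / 4` if the list is long. Lists of three and very
long lists are the tight cases. Exponentially many messages survive the union bounds
(`exists_code_small_inter`, `exists_code_quarter`). -/

lemma plotkinFun_pos_denom {ω : ℝ} (h : 0 ≤ ω) : 0 < 1 + 4 * ω ^ 3 := by positivity

/-- The endpoint values `0` and `2 / 5` lie below the value `26 / 59` at `2 / 3`, so the maximum is
at an interior critical point, where `1 + 3 w ^ 2 - 8 w ^ 3 = 0`. The crude localisation is what the
small codes need: `1 / 3 ≤ w` for lists of two, `w ≤ 2 / 3` for lists of at least five. -/
lemma exists_isMaxOn_plotkinFun :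
    ∃ w : ℝ, 1 / 3 ≤ w ∧ w ≤ 2 / 3 ∧ ∀ x ∈ Set.Icc (0 : ℝ) 1, plotkinFun x ≤ plotkinFun w := by
  have hcont : ContinuousOn plotkinFun (Set.Icc (0 : ℝ) 1) := by
    unfold plotkinFun
    refine ContinuousOn.div (by fun_prop) (by fun_prop) ?_
    intro x hx
    exact (plotkinFun_pos_denom hx.1).ne'
  obtain ⟨w, hw, hmax⟩ := isCompact_Icc.exists_isMaxOn ⟨(0 : ℝ), by norm_num⟩ hcont
  have hm : ∀ x ∈ Set.Icc (0 : ℝ) 1, plotkinFun x ≤ plotkinFun w := fun x hx => hmax hx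
  have h23 := hm (2 / 3) (by norm_num)
  have h0 : w ≠ 0 := by
    rintro rfl
    norm_num [plotkinFun] at h23
  have h1 : w ≠ 1 := by
    rintro rfl
    norm_num [plotkinFun] at h23
  have hpos : 0 < w := lt_of_le_of_ne hw.1 (Ne.symm h0)
  have hlt : w < 1 := lt_of_le_of_ne hw.2 h1
  have hloc : IsLocalMax plotkinFun w := hmax.isLocalMax (Icc_mem_nhds hpos hlt)
  have hD := plotkinFun_pos_denom hw.1
  have hder : HasDerivAt plotkinFun
      (((1 + 3 * w ^ 2) * (1 + 4 * w ^ 3) - (w + w ^ 3) * (4 * (3 * w ^ 2))) /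
        (1 + 4 * w ^ 3) ^ 2) w := by
    have hnum : HasDerivAt (fun x : ℝ => x + x ^ 3) (1 + 3 * w ^ 2) w := by
      have h := (hasDerivAt_id w).add (hasDerivAt_pow 3 w)
      norm_num at h
      exact h
    have hden : HasDerivAt (fun x : ℝ => 1 + 4 * x ^ 3) (4 * (3 * w ^ 2)) w := by
      simpa using ((hasDerivAt_pow 3 w).const_mul 4).const_add 1
    exact hnum.div hden hD.ne'
  have hz := hloc.hasDerivAt_eq_zero hder
  have hcrit : w ^ 2 * (8 * w - 3) = 1 := by
    rw [div_eq_zero_iff] at hz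
    rcases hz with hz | hz
    · linarith
    · exact absurd hz (by positivity)
  refine ⟨w, ?_, ?_, hm⟩
  · by_contra! h
    nlinarith [sq_nonneg w]
  · by_contra! h
    have : 4 / 9 < w ^ 2 := by nlinarith
    nlinarith

lemma plotkinFun_lt {ω : ℝ} (h : 0 ≤ ω) : plotkinFun ω < 0.445 := by
  rw [plotkinFun, div_lt_iff₀ (plotkinFun_pos_denom h)]
  -- The claim is `0 < 0.78 ω ^ 3 - ω + 0.445`. The cubic has its minimum near `0.654`, and `(ω + 2
  -- r) (ω - r) ^ 2` has no quadratic term, whence `1.308 = 2 * 0.654`.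
  nlinarith [mul_nonneg (add_nonneg h (by norm_num : (0 : ℝ) ≤ 1.308)) (sq_nonneg (ω - 0.654))]

lemma plotkinFun_two_thirds : plotkinFun (2 / 3) = 26 / 59 := by
  norm_num [plotkinFun]

lemma exists_isGreatest_plotkinFun :
    ∃ w : ℝ, 1 / 3 ≤ w ∧ w ≤ 2 / 3 ∧ plotkinFun w = tauMax ∧
      IsGreatest (plotkinFun '' Set.Ioo (0 : ℝ) 1) tauMax ∧
      ∀ x ∈ Set.Icc (0 : ℝ) 1, plotkinFun x ≤ tauMax := by
  obtain ⟨w, h1, h2, hmax⟩ := exists_isMaxOn_plotkinFun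
  have hg : IsGreatest (plotkinFun '' Set.Ioo (0 : ℝ) 1) (plotkinFun w) := by
    refine ⟨⟨w, ⟨by linarith, by linarith⟩, rfl⟩, ?_⟩
    rintro _ ⟨x, hx, rfl⟩
    exact hmax x ⟨hx.1.le, hx.2.le⟩
  have he : plotkinFun w = tauMax := hg.csSup_eq.symm
  exact ⟨w, h1, h2, he, he ▸ hg, he ▸ hmax⟩

lemma tauMax_ge : 26 / 59 ≤ tauMax := by
  obtain ⟨w, -, -, -, -, h⟩ := exists_isGreatest_plotkinFun
  rw [← plotkinFun_two_thirds]
  exact h _ (by norm_num)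

/-- At every feedback moment and every weight of the first stage, one of the two strategies of the
adversary succeeds beyond `tauMax`. -/
lemma le_tauMax_of_le_of_le {ω a b s : ℝ} (h0 : 0 ≤ ω) (h1 : ω ≤ 1) (ha : 0 ≤ a) (hb : 0 ≤ b)
    (hA : s ≤ ω * a + b / 4) (hB : s ≤ (ω - ω ^ 3) * a + b / 2) : s ≤ tauMax * (a + b) := by
  obtain ⟨w, -, -, -, -, h⟩ := exists_isGreatest_plotkinFun
  have hf := h ω ⟨h0, h1⟩
  have ht := tauMax_ge
  have hD := plotkinFun_pos_denom h0
  rw [plotkinFun, div_le_iff₀ hD] at hf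
  -- At `b = 4 ω ^ 3 a` both bounds, divided by `a + b`, equal `plotkinFun ω`. For larger `b` the
  -- first one decreases if `ω ≥ 1 / 4`, and is at most `1 / 4` otherwise. For smaller `b` the
  -- second one decreases as `b` does, because `ω - ω ^ 3 ≤ 1 / 2`.
  rcases le_total (4 * ω ^ 3 * a) b with hc | hc
  · rcases le_total ω (1 / 4) with hw | hw
    · nlinarith [mul_le_mul_of_nonneg_right hw ha]
    · have hs : s * (1 + 4 * ω ^ 3) ≤ (ω + ω ^ 3) * (a + b) := by
        nlinarith [mul_nonneg (sub_nonneg.2 hc) (sub_nonneg.2 hw),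
          mul_le_mul_of_nonneg_right hA hD.le]
      have := mul_le_mul_of_nonneg_right hf (add_nonneg ha hb)
      nlinarith
  · have hk : ω - ω ^ 3 ≤ 1 / 2 := by nlinarith [sq_nonneg (ω - 0.6), mul_nonneg h0 (sq_nonneg (ω - 0.6))]
    have hs : s * (1 + 4 * ω ^ 3) ≤ (ω + ω ^ 3) * (a + b) := by
      nlinarith [mul_nonneg (sub_nonneg.2 hc) (sub_nonneg.2 hk),
        mul_le_mul_of_nonneg_right hB hD.le]
    have := mul_le_mul_of_nonneg_right hf (add_nonneg ha hb)
    nlinarith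

/-! ### Errors and confusability -/

/-- The number of ones of a word. -/
def weight {n : ℕ} (x : Word n) : ℕ := (Finset.univ.filter fun i => x i = true).card

lemma weight_le {n : ℕ} (x : Word n) : weight x ≤ n := by
  simpa [weight] using Finset.card_le_univ (Finset.univ.filter fun i => x i = true)

lemma numErrors_add_weight {n : ℕ} {x y : Word n} (h : CanReceive x y) :
    numErrors x y + weight y = weight x := by
  unfold numErrors weight
  rw [← Finset.card_union_of_disjoint]
  · congr 1
    ext i
    have := h i
    cases hx : x i <;> cases hy : y i <;> simp_all
  · rw [Finset.disjoint_filter]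
    rintro i - ⟨-, h1⟩ h2
    simp_all

lemma numErrors_add_weight_comm {n : ℕ} (x y : Word n) :
    numErrors x y + weight y = numErrors y x + weight x := by
  have hx : CanReceive x (fun i => x i && y i) := fun i => by simp +contextual
  have hy : CanReceive y (fun i => x i && y i) := fun i => by simp +contextual
  have h1 : numErrors x (fun i => x i && y i) = numErrors x y := by
    unfold numErrors; congr 1; ext i; cases hx : x i <;> cases hy : y i <;> simp_all
  have h2 : numErrors y (fun i => x i && y i) = numErrors y x := by
    unfold numErrors; congr 1; ext i; cases hx : x i <;> cases hy : y i <;> simp_all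
  have := numErrors_add_weight hx
  have := numErrors_add_weight hy
  omega

lemma numErrors_le_of_canReceive {n : ℕ} {x x' y : Word n} (h : CanReceive x' y) :
    numErrors x x' ≤ numErrors x y := by
  unfold numErrors
  refine Finset.card_le_card ?_
  intro i
  have := h i
  simp only [Finset.mem_filter, Finset.mem_univ, true_and]
  cases hx : x' i <;> cases hy : y i <;> simp_all

/-- Otherwise the meet of the two second-stage words would be a common output of both messages. -/
lemma TwoStageEncoder.Corrects.lt_or_lt {n₁ n₂ M t : ℕ} {E : TwoStageEncoder n₁ n₂ M}
    (hE : E.Corrects t) {m m' : Fin M} (hm : m ≠ m') {y : Word n₁}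
    (h : CanReceive (E.first m) y) (h' : CanReceive (E.first m') y) :
    t < numErrors (E.first m) y + numErrors (E.second m y) (E.second m' y) ∨
    t < numErrors (E.first m') y + numErrors (E.second m' y) (E.second m y) := by
  by_contra! hc
  obtain ⟨dec, hdec⟩ := hE
  set x := E.second m y
  set x' := E.second m' y
  have h1 : numErrors x (fun i => x i && x' i) = numErrors x x' := by
    unfold numErrors; congr 1; ext i; cases hx : x i <;> cases hy : x' i <;> simp_all
  have h2 : numErrors x' (fun i => x i && x' i) = numErrors x' x := by
    unfold numErrors; congr 1; ext i; cases hx : x i <;> cases hy : x' i <;> simp_all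
  have e1 := hdec m y (fun i => x i && x' i)
    ⟨h, fun i => by simp +contextual [x, x'], by rw [h1]; exact hc.1⟩
  have e2 := hdec m' y (fun i => x i && x' i)
    ⟨h', fun i => by simp +contextual [x, x'], by rw [h2]; exact hc.2⟩
  exact hm (e1.symm.trans e2)

/-- The meet is the cheapest common second output: any other common output costs each message at
least as much. -/
lemma TwoStageEncoder.corrects_of_lt_or_lt {n₁ n₂ M t : ℕ} (hM : 0 < M)
    (E : TwoStageEncoder n₁ n₂ M)
    (hE : ∀ m m' : Fin M, m ≠ m' → ∀ y, CanReceive (E.first m) y → CanReceive (E.first m') y →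
      t < numErrors (E.first m) y + numErrors (E.second m y) (E.second m' y) ∨
      t < numErrors (E.first m') y + numErrors (E.second m' y) (E.second m y)) :
    E.Corrects t := by
  classical
  refine ⟨fun y₁ y₂ => if h : ∃ m, E.IsOutput t m y₁ y₂ then h.choose else ⟨0, hM⟩, ?_⟩
  intro m y₁ y₂ hm
  have hex : ∃ m, E.IsOutput t m y₁ y₂ := ⟨m, hm⟩
  simp only [dif_pos hex]
  obtain ⟨a1, a2, a3⟩ := hex.choose_spec
  obtain ⟨b1, b2, b3⟩ := hm
  by_contra hne
  have h1 := numErrors_le_of_canReceive (x := E.second hex.choose y₁) b2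
  have h2 := numErrors_le_of_canReceive (x := E.second m y₁) a2
  rcases hE _ _ hne y₁ a1 b1 with h | h <;> omega

/-! ### The converse -/

/-- Many real numbers in `[0, 1]` contain many that are close to each other. -/
lemma exists_large_subset_close {α : Type*} (S : Finset α) (v : α → ℝ)
    (hv : ∀ m ∈ S, 0 ≤ v m ∧ v m ≤ 1) {D B : ℕ} (hD : 0 < D) (hS : (D + 1) * B < S.card) :
    ∃ S' ⊆ S, B < S'.card ∧ ∃ ω : ℝ, 0 ≤ ω ∧ ω ≤ 1 ∧ ∀ m ∈ S', ω ≤ v m ∧ v m ≤ ω + 1 / D := by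
  classical
  have hD' : (0 : ℝ) < D := by exact_mod_cast hD
  -- The value `1` falls into a cell of its own, hence `D + 1` cells.
  have hmaps : ∀ m ∈ S, ⌊v m * D⌋₊ ∈ Finset.range (D + 1) := by
    intro m hm
    rw [Finset.mem_range, Nat.lt_succ_iff]
    refine Nat.floor_le_of_le ?_
    nlinarith [(hv m hm).2]
  obtain ⟨j, hj, hcard⟩ := Finset.exists_lt_card_fiber_of_mul_lt_card_of_maps_to hmaps
    (n := B) (by simpa using hS)
  have hjD : (j : ℝ) ≤ D := by
    exact_mod_cast Nat.lt_succ_iff.1 (Finset.mem_range.1 hj)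
  refine ⟨_, Finset.filter_subset _ _, hcard, j / D, by positivity, (div_le_one hD').2 hjD, ?_⟩
  intro m hm
  obtain ⟨hmS, hmj⟩ := Finset.mem_filter.1 hm
  rw [← add_div, div_le_iff₀ hD', le_div_iff₀ hD', ← hmj]
  exact ⟨Nat.floor_le (mul_nonneg (hv m hmS).1 hD'.le), (Nat.lt_floor_add_one _).le⟩

/-- The Plotkin bound, as a double count. -/
lemma four_mul_sum_numErrors_le {α : Type*} (S : Finset α) {n : ℕ} (c : α → Word n) :
    4 * ∑ a ∈ S, ∑ b ∈ S, numErrors (c a) (c b) ≤ n * S.card ^ 2 := by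
  classical
  have h : ∑ a ∈ S, ∑ b ∈ S, numErrors (c a) (c b) =
      ∑ i : Fin n, (S.filter fun a => c a i = true).card *
        (S.filter fun a => ¬ c a i = true).card := by
    simp only [numErrors, Finset.card_filter, Finset.sum_mul_sum]
    calc _ = ∑ a ∈ S, ∑ i : Fin n, ∑ b ∈ S, if c a i = true ∧ c b i = false then 1 else 0 :=
          Finset.sum_congr rfl fun a _ => Finset.sum_comm
      _ = ∑ i : Fin n, ∑ a ∈ S, ∑ b ∈ S, if c a i = true ∧ c b i = false then 1 else 0 :=
          Finset.sum_comm
      _ = _ := by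
          refine Finset.sum_congr rfl fun i _ => Finset.sum_congr rfl fun a _ =>
            Finset.sum_congr rfl fun b _ => ?_
          cases c a i <;> cases c b i <;> simp
  rw [h, Finset.mul_sum]
  calc _ ≤ ∑ _i : Fin n, S.card ^ 2 := by
        refine Finset.sum_le_sum fun i _ => ?_
        rw [← Finset.card_filter_add_card_filter_not (s := S) (fun a => c a i = true)]
        nlinarith [four_mul_le_sq_add (S.filter fun a => c a i = true).card
          (S.filter fun a => ¬ c a i = true).card]
    _ = n * S.card ^ 2 := by simp

/-- The Plotkin bound for the Z-channel: few words of almost equal weights can be pairwise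
distinguished for more than a quarter of errors. -/
lemma le_quarter_of_pairwise {α : Type*} (S : Finset α) {n D : ℕ} (c : α → Word n) (hD : 0 < D)
    (hS : 3 * D < S.card) {ω s : ℝ}
    (hw : ∀ a ∈ S, ω ≤ weight (c a) ∧ (weight (c a) : ℝ) ≤ ω + n / D)
    (hs : ∀ a ∈ S, ∀ b ∈ S, a ≠ b →
      s ≤ numErrors (c a) (c b) ∨ s ≤ numErrors (c b) (c a)) :
    s ≤ n / 4 + 2 * n / D := by
  classical
  have hD' : (1 : ℝ) ≤ D := by exact_mod_cast hD
  have hB : 3 * (D : ℝ) + 1 ≤ S.card := by exact_mod_cast hS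
  have hn : (0 : ℝ) ≤ n := n.cast_nonneg
  -- `numErrors` in the two directions differs by the difference of the weights, so a bound in one
  -- direction gives almost the same bound in the other.
  have key : ∀ a ∈ S, ∀ b ∈ S, a ≠ b → s - n / D ≤ numErrors (c a) (c b) := by
    intro a ha b hb hab
    have h1 : (numErrors (c a) (c b) : ℝ) + weight (c b) = numErrors (c b) (c a) + weight (c a) := by
      exact_mod_cast numErrors_add_weight_comm (c a) (c b)
    have h2 := hw a ha
    have h3 := hw b hb
    have h4 : (0 : ℝ) ≤ n / D := by positivity
    rcases hs a ha b hb hab with h | h <;> linarith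
  have hsum : (S.card : ℝ) * ((S.card - 1) * (s - n / D)) ≤
      ∑ a ∈ S, ∑ b ∈ S, (numErrors (c a) (c b) : ℝ) := by
    rw [← nsmul_eq_mul]
    refine Finset.card_nsmul_le_sum _ _ _ fun a ha => ?_
    calc ((S.card : ℝ) - 1) * (s - n / D) = (S.erase a).card • (s - n / D) := by
          rw [nsmul_eq_mul, Finset.card_erase_of_mem ha, Nat.cast_sub (by omega), Nat.cast_one]
      _ ≤ ∑ b ∈ S.erase a, (numErrors (c a) (c b) : ℝ) :=
          Finset.card_nsmul_le_sum _ _ _ fun b hb =>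
            key a ha b (Finset.mem_of_mem_erase hb) (Finset.ne_of_mem_erase hb).symm
      _ ≤ ∑ b ∈ S, (numErrors (c a) (c b) : ℝ) :=
          Finset.sum_le_sum_of_subset_of_nonneg (Finset.erase_subset _ _)
            fun _ _ _ => Nat.cast_nonneg _
  have hpl : 4 * ∑ a ∈ S, ∑ b ∈ S, (numErrors (c a) (c b) : ℝ) ≤ n * (S.card : ℝ) ^ 2 := by
    exact_mod_cast four_mul_sum_numErrors_le S c
  set B : ℝ := (S.card : ℝ)
  have hBpos : 0 < B := by linarith
  have h1 : 4 * ((B - 1) * (s - n / D)) ≤ n * B := by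
    refine le_of_mul_le_mul_left ?_ hBpos
    nlinarith
  have h2 : n ≤ (n / D : ℝ) * (B - 1) := by
    have : (n : ℝ) = n / D * D := by field_simp
    have h4 : (0 : ℝ) ≤ n / D := by positivity
    nlinarith
  have h3 : 4 * (B - 1) * s ≤ 4 * (B - 1) * (n / 4 + 2 * n / D) := by
    have : 2 * (n : ℝ) / D = 2 * (n / D) := by ring
    rw [this]
    nlinarith
  exact le_of_mul_le_mul_left h3 (by linarith)

/-- Among many words of large weight, three have a large common support. -/
lemma exists_triple_large_inter {α : Type*} (S : Finset α) {n : ℕ} (c : α → Word n)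
    (hS : 3 ≤ S.card) {ω : ℝ} (h0 : 0 ≤ ω) (hw : ∀ a ∈ S, ω * n ≤ weight (c a)) :
    ∃ a ∈ S, ∃ b ∈ S, ∃ d ∈ S, a ≠ b ∧ b ≠ d ∧ a ≠ d ∧
      (ω ^ 3 - 4 / S.card) * n ≤ weight (fun i => c a i && (c b i && c d i)) := by
  classical
  by_contra! hcon
  rcases Nat.eq_zero_or_pos n with hn0 | hn
  · subst hn0
    obtain ⟨a, b, d, ha, hb, hd, hab, had, hbd⟩ := Finset.two_lt_card_iff.1 hS
    have := hcon a ha b hb d hd hab hbd had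
    simp at this
    have h' : (0 : ℝ) ≤ weight (fun i => c a i && (c b i && c d i)) := Nat.cast_nonneg _
    linarith
  have hn' : (0 : ℝ) < n := by exact_mod_cast hn
  set B : ℝ := (S.card : ℝ) with hBdef
  have hB : 0 < B := by rw [hBdef]; exact_mod_cast (by omega : 0 < S.card)
  set θ : ℝ := ω ^ 3 - 4 / B with hθ
  -- Positivity allows `θ * n` to be charged to triples with repeated entries as well.
  have hθn : 0 < θ * n := by
    obtain ⟨a, b, d, ha, hb, hd, hab, had, hbd⟩ := Finset.two_lt_card_iff.1 hS
    exact lt_of_le_of_lt (Nat.cast_nonneg _) (hcon a ha b hb d hd hab hbd had)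
  let k : Fin n → ℝ := fun i => ∑ a ∈ S, if c a i = true then 1 else 0
  have hk : ω * n * B ≤ ∑ i, k i := by
    rw [Finset.sum_comm, mul_comm, hBdef, ← nsmul_eq_mul]
    refine Finset.card_nsmul_le_sum _ _ _ fun a ha => ?_
    have := hw a ha
    simpa [weight] using this
  -- Summing over ordered triples with repetition gives exact cubes of the column sums, ready for
  -- the power mean inequality. The at most `3 B ^ 2` degenerate triples use up three of the four
  -- units in `4 / B`; the last one gives the contradiction.
  have htot : ∑ a ∈ S, ∑ b ∈ S, ∑ d ∈ S, (weight (fun i => c a i && (c b i && c d i)) : ℝ) =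
      ∑ i, k i ^ 3 := by
    have hterm : ∀ i, k i ^ 3 = ∑ a ∈ S, ∑ b ∈ S, ∑ d ∈ S,
        if (c a i && (c b i && c d i)) = true then (1 : ℝ) else 0 := by
      intro i
      simp only [k, pow_three]
      rw [Finset.sum_mul]
      refine Finset.sum_congr rfl fun a _ => ?_
      rw [Finset.sum_mul, Finset.mul_sum]
      refine Finset.sum_congr rfl fun b _ => ?_
      rw [Finset.mul_sum, Finset.mul_sum]
      refine Finset.sum_congr rfl fun d _ => ?_
      cases c a i <;> cases c b i <;> cases c d i <;> simp
    simp only [hterm, weight, Finset.card_filter, Nat.cast_sum, Nat.cast_ite, Nat.cast_one,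
      Nat.cast_zero]
    exact (Finset.sum_comm.trans (Finset.sum_congr rfl fun a _ => Finset.sum_comm.trans
      (Finset.sum_congr rfl fun b _ => Finset.sum_comm))).symm
  have hpow : (ω * n * B) ^ 3 / n ^ 2 ≤ ∑ i, k i ^ 3 := by
    have h := pow_sum_div_card_le_sum_pow (s := Finset.univ) (f := k)
      (fun i _ => Finset.sum_nonneg fun a _ => by split_ifs <;> norm_num) 2
    rw [Finset.card_univ, Fintype.card_fin] at h
    exact le_trans (by gcongr) h
  have hup : ∑ a ∈ S, ∑ b ∈ S, ∑ d ∈ S, (weight (fun i => c a i && (c b i && c d i)) : ℝ) ≤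
      B ^ 3 * (θ * n) + 3 * B ^ 2 * n := by
    calc _ ≤ ∑ a ∈ S, ∑ b ∈ S, ∑ d ∈ S, (θ * n + (if a = b then (n : ℝ) else 0) +
          (if b = d then (n : ℝ) else 0) + (if a = d then (n : ℝ) else 0)) := by
          refine Finset.sum_le_sum fun a ha => Finset.sum_le_sum fun b hb =>
            Finset.sum_le_sum fun d hd => ?_
          have hle : (weight (fun i => c a i && (c b i && c d i)) : ℝ) ≤ n := by
            exact_mod_cast weight_le _
          by_cases h1 : a = b
          · rw [if_pos h1]
            split_ifs <;> linarith
          by_cases h2 : b = d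
          · rw [if_pos h2]
            split_ifs <;> linarith
          by_cases h3 : a = d
          · rw [if_pos h3]
            split_ifs
            linarith
          rw [if_neg h1, if_neg h2, if_neg h3]
          linarith [hcon a ha b hb d hd h1 h2 h3]
      _ = _ := by
          have e1 : ∀ a ∈ S, ∀ b ∈ S, ∑ d ∈ S, (θ * n + (if a = b then (n : ℝ) else 0) +
              (if b = d then (n : ℝ) else 0) + (if a = d then (n : ℝ) else 0)) =
              B * (θ * n) + B * (if a = b then (n : ℝ) else 0) + n + n := by
            intro a ha b hb
            simp only [Finset.sum_add_distrib, Finset.sum_const, nsmul_eq_mul, Finset.sum_ite_eq,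
              ha, hb, if_true, hBdef]
          have e2 : ∀ a ∈ S, ∑ b ∈ S, (B * (θ * n) + B * (if a = b then (n : ℝ) else 0) + n + n) =
              B ^ 2 * (θ * n) + 3 * B * n := by
            intro a ha
            simp only [Finset.sum_add_distrib, Finset.sum_const, nsmul_eq_mul, Finset.sum_ite_eq,
              ha, if_true, ← Finset.mul_sum, ← hBdef]
            ring
          rw [Finset.sum_congr rfl fun a ha => (Finset.sum_congr rfl (e1 a ha)).trans (e2 a ha)]
          rw [Finset.sum_const, nsmul_eq_mul, ← hBdef]
          ring
  have hfin := hpow.trans (htot ▸ hup)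
  have hl : (ω * n * B) ^ 3 / n ^ 2 = B ^ 3 * ω ^ 3 * n := by
    field_simp
  have hr : B ^ 3 * (θ * n) + 3 * B ^ 2 * n = B ^ 3 * ω ^ 3 * n - B ^ 2 * n := by
    rw [hθ]
    field_simp
    ring
  rw [hl, hr] at hfin
  have : 0 < B ^ 2 * n := by positivity
  linarith

/-- Two of any three words are confusable if half of the positions may be erroneous. -/
lemma exists_pair_numErrors_le_half {n : ℕ} (x : Fin 3 → Word n) :
    ∃ i j, i ≠ j ∧ 2 * numErrors (x i) (x j) ≤ n ∧ 2 * numErrors (x j) (x i) ≤ n := by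
  have hdis : ∀ a b d : Word n, numErrors a b + numErrors b d ≤ n := by
    intro a b d
    unfold numErrors
    rw [← Finset.card_union_of_disjoint]
    · simpa using Finset.card_le_univ (α := Fin n) _
    · rw [Finset.disjoint_filter]
      rintro i - ⟨-, h1⟩ h2
      simp_all
  -- Orient each pair in a direction with more than `n / 2` errors. A tournament on three vertices
  -- contains a directed path of length two, which contradicts `hdis`.
  by_contra! hcon
  have h01 := hcon 0 1 (by decide)
  have h12 := hcon 1 2 (by decide)
  have h02 := hcon 0 2 (by decide)
  have d1 := hdis (x 0) (x 1) (x 2)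
  have d2 := hdis (x 0) (x 2) (x 1)
  have d3 := hdis (x 1) (x 0) (x 2)
  have d4 := hdis (x 1) (x 2) (x 0)
  have d5 := hdis (x 2) (x 0) (x 1)
  have d6 := hdis (x 2) (x 1) (x 0)
  omega

/-- The two strategies of the adversary, with error terms. One factor `D + 1` in `hM` pays for
equalising the weights in the first stage, the other for those in the second stage after an all-zero
first output. -/
lemma TwoStageEncoder.Corrects.le_tauMax {n₁ n₂ M t D : ℕ} {E : TwoStageEncoder n₁ n₂ M}
    (hE : E.Corrects t) (hD : 0 < D) (h₁ : 0 < n₁) (h₂ : 0 < n₂)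
    (hM : (D + 1) * ((D + 1) * (4 * D)) < M) :
    (t : ℝ) ≤ tauMax * (n₁ + n₂) + 3 * (n₁ + n₂) / D := by
  classical
  have hD' : (0 : ℝ) < D := by exact_mod_cast hD
  have h₁' : (0 : ℝ) < n₁ := by exact_mod_cast h₁
  have h₂' : (0 : ℝ) < n₂ := by exact_mod_cast h₂
  have hunit : ∀ {n : ℕ} (_ : (0 : ℝ) < n) (x : Word n),
      0 ≤ (weight x / n : ℝ) ∧ (weight x / n : ℝ) ≤ 1 := by
    intro n hn x
    refine ⟨by positivity, (div_le_one hn).2 ?_⟩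
    exact_mod_cast weight_le x
  obtain ⟨S, -, hScard, ω, hω0, hω1, hω⟩ := exists_large_subset_close Finset.univ
    (fun m => (weight (E.first m) / n₁ : ℝ)) (fun m _ => hunit h₁' _) hD
    (B := (D + 1) * (4 * D)) (by simpa using hM)
  have hw : ∀ m ∈ S, ω * n₁ ≤ weight (E.first m) ∧
      (weight (E.first m) : ℝ) ≤ ω * n₁ + n₁ / D := by
    intro m hm
    obtain ⟨h1, h2⟩ := hω m hm
    rw [le_div_iff₀ h₁'] at h1
    rw [div_le_iff₀ h₁'] at h2
    exact ⟨h1, h2.trans (le_of_eq (by ring))⟩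
  set s : ℝ := t - (2 * n₁ / D + 2 * n₂ / D) with hs
  have hq₁ : (0 : ℝ) ≤ n₁ / D := by positivity
  have hq₂ : (0 : ℝ) ≤ n₂ / D := by positivity
  have e₁ : 2 * (n₁ : ℝ) / D = 2 * (n₁ / D) := by ring
  have e₂ : 2 * (n₂ : ℝ) / D = 2 * (n₂ / D) := by ring
  have hA : s ≤ ω * n₁ + n₂ / 4 := by
    obtain ⟨S', hS', hcard', ω', -, -, hω'⟩ := exists_large_subset_close S
      (fun m => (weight (E.second m fun _ => false) / n₂ : ℝ)) (fun m _ => hunit h₂' _) hD hScard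
    have := le_quarter_of_pairwise S' (D := D) (fun m => E.second m fun _ => false) hD (by omega)
      (ω := ω' * n₂) (s := t - (ω * n₁ + n₁ / D)) ?_ ?_
    · linarith
    · intro m hm
      obtain ⟨h1, h2⟩ := hω' m hm
      rw [le_div_iff₀ h₂'] at h1
      rw [div_le_iff₀ h₂'] at h2
      exact ⟨h1, h2.trans (le_of_eq (by ring))⟩
    · intro a ha b hb hab
      have hz : ∀ x : Word n₁, CanReceive x fun _ => false := fun x i hi => by simp at hi
      have hwt : ∀ m ∈ S', (numErrors (E.first m) (fun _ => false) : ℝ) ≤ ω * n₁ + n₁ / D := by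
        intro m hm
        refine le_trans ?_ (hw m (hS' hm)).2
        exact_mod_cast (Nat.le_add_right _ _).trans (numErrors_add_weight (hz (E.first m))).le
      refine (hE.lt_or_lt hab (hz _) (hz _)).imp (fun h => ?_) (fun h => ?_)
      · have h' : (t : ℝ) ≤ numErrors (E.first a) (fun _ => false) +
          numErrors (E.second a fun _ => false) (E.second b fun _ => false) := by
          exact_mod_cast h.le
        linarith [hwt a ha]
      · have h' : (t : ℝ) ≤ numErrors (E.first b) (fun _ => false) +
          numErrors (E.second b fun _ => false) (E.second a fun _ => false) := by
          exact_mod_cast h.le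
        linarith [hwt b hb]
  have hB : s ≤ (ω - ω ^ 3) * n₁ + n₂ / 2 := by
    have hcard4 : 4 * D < S.card := lt_of_le_of_lt (Nat.le_mul_of_pos_left _ (by omega)) hScard
    obtain ⟨a, ha, b, hb, d, hd, hab, hbd, had, hint⟩ :=
      exists_triple_large_inter S E.first (by omega) hω0 (fun m hm => (hw m hm).1)
    set y : Word n₁ := fun i => E.first a i && (E.first b i && E.first d i) with hy
    let x : Fin 3 → Fin M := ![a, b, d]
    have hxS : ∀ i, x i ∈ S := by
      intro i; fin_cases i <;> assumption
    have hxinj : ∀ i j, i ≠ j → x i ≠ x j := by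
      intro i j; fin_cases i <;> fin_cases j <;> simp [x, hab, hbd, had, Ne.symm hab, Ne.symm hbd,
        Ne.symm had]
    have hrec : ∀ i, CanReceive (E.first (x i)) y := by
      intro i l hl
      fin_cases i <;> simp_all [x]
    have hsmall : 4 / (S.card : ℝ) ≤ 1 / D := by
      rw [div_le_div_iff₀ (by exact_mod_cast (by omega : 0 < S.card)) hD']
      rw [one_mul]
      exact_mod_cast hcard4.le
    have hyw : ω ^ 3 * n₁ - n₁ / D ≤ weight y := by
      have := mul_le_mul_of_nonneg_right hsmall h₁'.le
      have h' : 1 / (D : ℝ) * n₁ = n₁ / D := by ring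
      linarith
    have hcost : ∀ i, (numErrors (E.first (x i)) y : ℝ) ≤ (ω - ω ^ 3) * n₁ + 2 * (n₁ / D) := by
      intro i
      have h1 : (numErrors (E.first (x i)) y : ℝ) + weight y = weight (E.first (x i)) := by
        exact_mod_cast numErrors_add_weight (hrec i)
      linarith [(hw _ (hxS i)).2]
    obtain ⟨i, j, hij, h1, h2⟩ := exists_pair_numErrors_le_half fun i => E.second (x i) y
    have h1' : 2 * (numErrors (E.second (x i) y) (E.second (x j) y) : ℝ) ≤ n₂ := by
      exact_mod_cast h1
    have h2' : 2 * (numErrors (E.second (x j) y) (E.second (x i) y) : ℝ) ≤ n₂ := by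
      exact_mod_cast h2
    rcases hE.lt_or_lt (hxinj i j hij) (hrec i) (hrec j) with h | h
    · have h' : (t : ℝ) ≤ numErrors (E.first (x i)) y +
          numErrors (E.second (x i) y) (E.second (x j) y) := by exact_mod_cast h.le
      linarith [hcost i]
    · have h' : (t : ℝ) ≤ numErrors (E.first (x j)) y +
          numErrors (E.second (x j) y) (E.second (x i) y) := by exact_mod_cast h.le
      linarith [hcost j]
  have hmax := le_tauMax_of_le_of_le hω0 hω1 h₁'.le h₂'.le hA hB
  have e₃ : 3 * ((n₁ : ℝ) + n₂) / D = 3 * (n₁ / D) + 3 * (n₂ / D) := by ring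
  linarith

lemma exists_maxMessages_le {τ : ℝ} (hτ : tauMax < τ) :
    ∃ C : ℕ, 1 ≤ C ∧ ∀ᶠ n : ℕ in atTop, maxMessages n ⌊τ * n⌋₊ ≤ C := by
  set η := τ - tauMax with hη
  have hη0 : 0 < η := sub_pos.2 hτ
  obtain ⟨D, hD⟩ := exists_nat_gt (4 / η)
  have hD0 : (0 : ℝ) < D := lt_trans (by positivity) hD
  have hDpos : 0 < D := by exact_mod_cast hD0
  obtain ⟨N, hN⟩ := exists_nat_gt (4 / η)
  refine ⟨(D + 1) * ((D + 1) * (4 * D)), Nat.one_le_iff_ne_zero.2 (by positivity), ?_⟩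
  filter_upwards [eventually_ge_atTop N, eventually_ge_atTop 3] with n hn hn3
  obtain ⟨n₁, n₂, h1, h2, rfl, E, hE⟩ := (isGreatest_maxMessages hn3 ⌊τ * n⌋₊).1
  by_contra! hcon
  have hle := hE.le_tauMax hDpos (by omega) h2 hcon
  have hfl := Nat.lt_floor_add_one (τ * (n₁ + n₂ : ℕ))
  have hn' : 4 / η < ((n₁ + n₂ : ℕ) : ℝ) := hN.trans_le (by exact_mod_cast hn)
  push_cast at hfl hn' hle
  set n : ℝ := (n₁ : ℝ) + n₂
  rw [div_lt_iff₀ hη0] at hn' hD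
  have hn0 : 0 < n := by
    by_contra! h
    nlinarith
  -- Of the slack `η * n`, three quarters absorb the loss in `D`; the last quarter exceeds the
  -- rounding of `τ * n`.
  have h3 : 3 * n / D ≤ 3 / 4 * η * n := by
    rw [div_le_iff₀ hD0]
    nlinarith
  have hτe : τ = tauMax + η := by rw [hη]; ring
  rw [hτe] at hfl hle
  linarith

lemma one_le_maxMessages {n : ℕ} (hn : 3 ≤ n) (t : ℕ) : 1 ≤ maxMessages n t :=
  (isGreatest_maxMessages hn t).2 (transmittable_one hn t)

lemma rate_eq_zero {τ : ℝ} (hτ : tauMax < τ) : rate τ = 0 := by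
  obtain ⟨C, hC1, hC⟩ := exists_maxMessages_le hτ
  refine Tendsto.limsup_eq ?_
  refine tendsto_of_tendsto_of_tendsto_of_le_of_le' tendsto_const_nhds
    (tendsto_const_div_atTop_nhds_zero_nat (Real.logb 2 C)) ?_ ?_
  · filter_upwards [eventually_ge_atTop 3] with n hn
    refine div_nonneg (Real.logb_nonneg (by norm_num) ?_) n.cast_nonneg
    exact_mod_cast one_le_maxMessages hn _
  · filter_upwards [eventually_ge_atTop 3, hC] with n hn hle
    refine div_le_div_of_nonneg_right ?_ n.cast_nonneg
    refine Real.logb_le_logb_of_le (by norm_num) ?_ (by exact_mod_cast hle)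
    exact_mod_cast one_le_maxMessages hn _

/-! ### Random codes -/

/-- Use `exp x ≤ 1 + x + x ^ 2` for `|x| ≤ 1`; the linear term has mean zero. -/
lemma sum_mul_exp_le {Ω : Type*} [Fintype Ω] (P X : Ω → ℝ) (hP : ∀ a, 0 ≤ P a)
    (hP1 : ∑ a, P a = 1) (hX : ∀ a, 0 ≤ X a ∧ X a ≤ 1) {l : ℝ} (hl0 : 0 ≤ l) (hl1 : l ≤ 1) :
    ∑ a, P a * Real.exp (l * (X a - ∑ b, P b * X b)) ≤ Real.exp (l ^ 2) := by
  set μ := ∑ b, P b * X b with hμ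
  have hμ0 : 0 ≤ μ := Finset.sum_nonneg fun a _ => mul_nonneg (hP a) (hX a).1
  have hμ1 : μ ≤ 1 := by
    rw [← hP1]
    exact Finset.sum_le_sum fun a _ => mul_le_of_le_one_right (hP a) (hX a).2
  calc _ ≤ ∑ a, P a * (1 + l * (X a - μ) + l ^ 2) := by
        refine Finset.sum_le_sum fun a _ => mul_le_mul_of_nonneg_left ?_ (hP a)
        have hy : |X a - μ| ≤ 1 := by
          rw [abs_le]
          constructor <;> linarith [(hX a).1, (hX a).2]
        have hle : |l * (X a - μ)| ≤ 1 := by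
          rw [abs_mul, abs_of_nonneg hl0]
          exact mul_le_one₀ hl1 (abs_nonneg _) hy
        have h := (abs_le.1 (Real.abs_exp_sub_one_sub_id_le hle)).2
        have h2 : (l * (X a - μ)) ^ 2 ≤ l ^ 2 := by
          rw [mul_pow]
          exact mul_le_of_le_one_right (sq_nonneg _) ((sq_le_one_iff_abs_le_one _).2 hy)
        linarith
    _ = 1 + l ^ 2 := by
        have : ∀ a, P a * (1 + l * (X a - μ) + l ^ 2) =
            P a * (1 + l ^ 2 - l * μ) + l * (P a * X a) := fun a => by ring
        simp only [this, Finset.sum_add_distrib, ← Finset.sum_mul, ← Finset.mul_sum, hP1, ← hμ]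
        ring
    _ ≤ Real.exp (l ^ 2) := by linarith [Real.add_one_le_exp (l ^ 2)]

/-- A Chernoff and union bound: some sample has all empirical means below the expectations plus
`ε`. -/
lemma exists_sample_sum_lt {Ω K : Type*} [Fintype Ω] [Fintype K] (P : Ω → ℝ) (X : K → Ω → ℝ)
    (hP : ∀ a, 0 ≤ P a) (hP1 : ∑ a, P a = 1) (hX : ∀ k a, 0 ≤ X k a ∧ X k a ≤ 1) {n : ℕ} {ε : ℝ}
    (hε0 : 0 < ε) (hε1 : ε ≤ 1) (hK : Fintype.card K < Real.exp (ε ^ 2 / 4 * n)) :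
    ∃ s : Fin n → Ω, ∀ k, ∑ i, X k (s i) < (∑ a, P a * X k a + ε) * n := by
  classical
  by_contra! hcon
  set μ : K → ℝ := fun k => ∑ a, P a * X k a
  -- This minimises the exponent `l ^ 2 - l * ε`.
  set l : ℝ := ε / 2 with hl
  have h1 : (1 : ℝ) ≤ ∑ s : Fin n → Ω, ∑ k,
      Real.exp (-(l * ε * n)) * ∏ i, (P (s i) * Real.exp (l * (X k (s i) - μ k))) := by
    calc (1 : ℝ) = ∑ s : Fin n → Ω, ∏ i, P (s i) := by rw [← Fintype.sum_pow, hP1, one_pow]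
      _ ≤ _ := by
        refine Finset.sum_le_sum fun s _ => ?_
        obtain ⟨k, hk⟩ := hcon s
        have hnn : 0 ≤ ∏ i, P (s i) := Finset.prod_nonneg fun i _ => hP _
        refine le_trans ?_ (Finset.single_le_sum (f := fun k => Real.exp (-(l * ε * n)) *
          ∏ i, (P (s i) * Real.exp (l * (X k (s i) - μ k)))) (fun k _ => ?_) (Finset.mem_univ k))
        · rw [Finset.prod_mul_distrib, ← Real.exp_sum, mul_left_comm, ← Real.exp_add]
          refine le_mul_of_one_le_right hnn (Real.one_le_exp ?_)
          rw [← Finset.mul_sum, Finset.sum_sub_distrib, Finset.sum_const, Finset.card_univ,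
            Fintype.card_fin, nsmul_eq_mul]
          have hl0 : 0 ≤ l := by positivity
          nlinarith [mul_le_mul_of_nonneg_left hk hl0]
        · exact mul_nonneg (Real.exp_pos _).le
            (Finset.prod_nonneg fun i _ => mul_nonneg (hP _) (Real.exp_pos _).le)
  have h2 : ∑ s : Fin n → Ω, ∑ k,
      Real.exp (-(l * ε * n)) * ∏ i, (P (s i) * Real.exp (l * (X k (s i) - μ k))) ≤
      ∑ _k : K, Real.exp (-(ε ^ 2 / 4 * n)) := by
    rw [Finset.sum_comm]
    refine Finset.sum_le_sum fun k _ => ?_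
    rw [← Finset.mul_sum,
      ← Fintype.sum_pow (fun a => P a * Real.exp (l * (X k a - μ k))) n]
    have hm := sum_mul_exp_le P (X k) hP hP1 (hX k) (l := l) (by positivity) (by linarith)
    calc _ ≤ Real.exp (-(l * ε * n)) * Real.exp (l ^ 2) ^ n := by
          gcongr
          exact Finset.sum_nonneg fun a _ => mul_nonneg (hP a) (Real.exp_pos _).le
      _ = Real.exp (-(ε ^ 2 / 4 * n)) := by
          rw [← Real.exp_nat_mul, ← Real.exp_add]
          congr 1
          rw [hl]
          ring
  have h3 := h1.trans h2
  rw [Finset.sum_const, Finset.card_univ, nsmul_eq_mul, Real.exp_neg, ← div_eq_mul_inv, le_div_iff₀ (Real.exp_pos _)] at h3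
  linarith

/-- The product Bernoulli distribution. -/
noncomputable def bernoulliWeight (w : ℝ) {M : ℕ} (a : Fin M → Bool) : ℝ :=
  ∏ m, if a m = true then w else 1 - w

lemma bernoulliWeight_nonneg {w : ℝ} (h0 : 0 ≤ w) (h1 : w ≤ 1) {M : ℕ} (a : Fin M → Bool) :
    0 ≤ bernoulliWeight w a :=
  Finset.prod_nonneg fun m _ => by split_ifs <;> linarith

/-- A sample point `a` is one column of a random code: the bits of all `M` words at one position.
The sum is the probability that all words of `S` have a one there. -/
lemma sum_bernoulliWeight_mul_indicator (w : ℝ) {M : ℕ} (S : Finset (Fin M)) :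
    ∑ a : Fin M → Bool, bernoulliWeight w a * (if ∀ m ∈ S, a m = true then 1 else 0) =
      w ^ S.card := by
  classical
  have h : ∀ a : Fin M → Bool, bernoulliWeight w a * (if ∀ m ∈ S, a m = true then 1 else 0) =
      ∏ m, if m ∈ S then (if a m = true then w else 0) else (if a m = true then w else 1 - w) := by
    intro a
    unfold bernoulliWeight
    split_ifs with hS
    · rw [mul_one]
      refine Finset.prod_congr rfl fun m _ => ?_
      by_cases hm : m ∈ S
      · simp [hm, hS m hm]
      · simp [hm]
    · push Not at hS
      obtain ⟨m, hm, hma⟩ := hS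
      rw [mul_zero, Finset.prod_eq_zero (Finset.mem_univ m)]
      simp [hm, hma]
  simp only [h]
  rw [← Fintype.prod_sum fun (m : Fin M) (b : Bool) =>
    if m ∈ S then (if b = true then w else 0) else (if b = true then w else 1 - w)]
  have h2 : ∀ m, (∑ b : Bool, if m ∈ S then (if b = true then w else 0)
      else (if b = true then w else 1 - w)) = if m ∈ S then w else 1 := by
    intro m
    by_cases hm : m ∈ S <;> simp [hm]
  simp only [h2]
  rw [Finset.prod_ite_mem, Finset.univ_inter, Finset.prod_const]

lemma sum_bernoulliWeight (w : ℝ) (M : ℕ) :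
    ∑ a : Fin M → Bool, bernoulliWeight w a = 1 := by
  simpa using sum_bernoulliWeight_mul_indicator w (∅ : Finset (Fin M))

/-- Random codes have words of weight about `w n`, such that any `k ≤ L` of them have at most about
`w ^ k n` common ones. -/
lemma exists_code_small_inter {M L n : ℕ} {w ε : ℝ} (h0 : 0 ≤ w) (h1 : w ≤ 1)
    (hε0 : 0 < ε) (hε1 : ε ≤ 1) (hM : (M : ℝ) + M ^ L < Real.exp (ε ^ 2 / 4 * n)) :
    ∃ c : Fin M → Word n, (∀ m, (w - ε) * n ≤ weight (c m)) ∧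
      ∀ S : Finset (Fin M), S.Nonempty → S.card ≤ L → ∀ y : Word n,
        (∀ m ∈ S, CanReceive (c m) y) → (weight y : ℝ) ≤ (w ^ S.card + ε) * n := by
  classical
  -- Tuples with repetition reach every nonempty set of at most `L` words. The complemented
  -- indicators in `X` turn the lower bound on weights into an upper bound, so one union bound
  -- covers both.
  let T : (Fin L → Fin M) → Finset (Fin M) := fun f => Finset.univ.image f
  let X : Fin M ⊕ (Fin L → Fin M) → (Fin M → Bool) → ℝ := fun k a =>
    Sum.elim (fun m => 1 - if ∀ m' ∈ ({m} : Finset (Fin M)), a m' = true then 1 else 0)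
      (fun f => if ∀ m' ∈ T f, a m' = true then 1 else 0) k
  obtain ⟨s, hs⟩ := exists_sample_sum_lt (bernoulliWeight w) X (bernoulliWeight_nonneg h0 h1)
    (sum_bernoulliWeight w M) (n := n) (ε := ε) (by
      rintro (m | f) a <;> simp only [X, Sum.elim_inl, Sum.elim_inr] <;> split_ifs <;> norm_num)
    hε0 hε1 (by simpa using hM)
  refine ⟨fun m i => s i m, fun m => ?_, ?_⟩
  · have h := hs (Sum.inl m)
    simp only [X, Sum.elim_inl, mul_sub, Finset.sum_sub_distrib,
      sum_bernoulliWeight_mul_indicator, mul_one, sum_bernoulliWeight] at h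
    have hw : (weight (fun i => s i m) : ℝ) =
        ∑ i, if ∀ m' ∈ ({m} : Finset (Fin M)), s i m' = true then (1 : ℝ) else 0 := by
      simp [weight]
    rw [hw]
    simp only [Finset.sum_const, Finset.card_univ, Fintype.card_fin, Finset.card_singleton, pow_one,
      nsmul_eq_mul, mul_one] at h
    linarith
  · intro S hSne hSL y hy
    obtain ⟨f, hf⟩ : ∃ f : Fin L → Fin M, T f = S := by
      have : Nonempty S := hSne.to_subtype
      obtain ⟨g⟩ : Nonempty (S ↪ Fin L) :=
        Function.Embedding.nonempty_of_card_le (by simpa using hSL)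
      refine ⟨fun i => (Function.invFun g i : S), ?_⟩
      ext m
      simp only [T, Finset.mem_image, Finset.mem_univ, true_and]
      constructor
      · rintro ⟨i, rfl⟩
        exact (Function.invFun g i : S).2
      · intro hm
        exact ⟨g ⟨m, hm⟩, by rw [Function.leftInverse_invFun g.injective]⟩
    have h := hs (Sum.inr f)
    simp only [X, Sum.elim_inr, sum_bernoulliWeight_mul_indicator, hf] at h
    refine le_trans ?_ h.le
    rw [weight, Finset.card_filter]
    push_cast
    refine Finset.sum_le_sum fun i _ => ?_
    by_cases hyi : y i = true
    · rw [if_pos hyi, if_pos fun m hm => hy m hm i hyi]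
    · rw [if_neg hyi]
      split_ifs <;> norm_num

/-- The Gilbert–Varshamov bound for the Z-channel. -/
lemma exists_code_quarter {M n : ℕ} {ε : ℝ} (hε0 : 0 < ε) (hε1 : ε ≤ 1)
    (hM : (M : ℝ) ^ 2 < Real.exp (ε ^ 2 / 4 * n)) :
    ∃ c : Fin M → Word n, ∀ i j, i ≠ j → (1 / 4 - ε) * n ≤ numErrors (c i) (c j) := by
  classical
  let X : Fin M × Fin M → (Fin M → Bool) → ℝ := fun k a =>
    1 - ((if ∀ m ∈ ({k.1} : Finset (Fin M)), a m = true then 1 else 0) -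
      if ∀ m ∈ ({k.1, k.2} : Finset (Fin M)), a m = true then 1 else 0)
  obtain ⟨s, hs⟩ := exists_sample_sum_lt (bernoulliWeight (1 / 2)) X
    (bernoulliWeight_nonneg (by norm_num) (by norm_num))
    (sum_bernoulliWeight _ M) (n := n) (ε := ε) (by
      rintro ⟨i, j⟩ a
      cases hi : a i <;> cases hj : a j <;> simp [X, hi, hj])
    hε0 hε1 (by simpa [sq] using hM)
  refine ⟨fun m i => s i m, fun i j hij => ?_⟩
  have h := hs (i, j)
  simp only [X, mul_sub, Finset.sum_sub_distrib,
    sum_bernoulliWeight_mul_indicator, mul_one, sum_bernoulliWeight, Finset.sum_const,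
    Finset.card_univ, Fintype.card_fin, Finset.card_singleton, pow_one, Finset.card_pair hij,
    nsmul_eq_mul] at h
  rw [← Finset.sum_sub_distrib] at h
  have hw : (numErrors (fun l => s l i) (fun l => s l j) : ℝ) =
      ∑ l, ((if ∀ m ∈ ({i} : Finset (Fin M)), s l m = true then (1 : ℝ) else 0) -
        if ∀ m ∈ ({i, j} : Finset (Fin M)), s l m = true then (1 : ℝ) else 0) := by
    rw [numErrors, Finset.card_filter]
    push_cast
    refine Finset.sum_congr rfl fun l _ => ?_
    cases hi : s l i <;> cases hj : s l j <;> simp [hi, hj]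
  rw [hw]
  linarith

/-! ### Codes with few words -/

/-- There is a code with `L` words of length `N`, such that each pair of words is distinguishable
if there are less than `d` errors. -/
def HasCode (L N d : ℕ) : Prop :=
  ∃ c : Fin L → Word N, ∀ i j, i ≠ j → d ≤ numErrors (c i) (c j) ∨ d ≤ numErrors (c j) (c i)

lemma HasCode.mono {L L' N d : ℕ} (h : HasCode L N d) (hL : L' ≤ L) : HasCode L' N d := by
  obtain ⟨c, hc⟩ := h
  exact ⟨fun i => c (Fin.castLE hL i), fun i j hij =>
    hc _ _ fun h => hij (Fin.castLE_injective hL h)⟩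

lemma HasCode.of_fintype {ι : Type*} [Fintype ι] {L d : ℕ} (c : Fin L → ι → Bool)
    (hc : ∀ i j, i ≠ j → d ≤ (Finset.univ.filter fun l => c i l = true ∧ c j l = false).card)
    {N : ℕ} (hN : Fintype.card ι ≤ N) : HasCode L N d := by
  classical
  obtain ⟨e⟩ : Nonempty (ι ↪ Fin N) := Function.Embedding.nonempty_of_card_le (by simpa using hN)
  refine ⟨fun i => Function.extend e (c i) fun _ => false, fun i j hij => Or.inl ?_⟩
  refine (hc i j hij).trans ?_
  rw [← Finset.card_map e]
  refine Finset.card_le_card ?_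
  intro l hl
  obtain ⟨p, hp, rfl⟩ := Finset.mem_map.1 hl
  simpa [e.injective.extend_apply] using hp

lemma HasCode.repeat {L N d : ℕ} (h : HasCode L N d) {k n : ℕ} (hn : N * k ≤ n) :
    HasCode L n (d * k) := by
  classical
  obtain ⟨c, hc⟩ := h
  obtain ⟨e⟩ : Nonempty (Fin N × Fin k ↪ Fin n) :=
    Function.Embedding.nonempty_of_card_le (by simpa using hn)
  have key : ∀ i j, numErrors (c i) (c j) * k ≤
      numErrors (Function.extend e (fun p => c i p.1) fun _ => false)
        (Function.extend e (fun p => c j p.1) fun _ => false) := by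
    intro i j
    calc numErrors (c i) (c j) * k =
        ((Finset.univ.filter fun l => c i l = true ∧ c j l = false) ×ˢ
          (Finset.univ : Finset (Fin k))).card := by
          rw [Finset.card_product, Finset.card_univ, Fintype.card_fin, numErrors]
      _ ≤ _ := by
          rw [← Finset.card_map e]
          refine Finset.card_le_card ?_
          intro l hl
          obtain ⟨p, hp, rfl⟩ := Finset.mem_map.1 hl
          simpa [e.injective.extend_apply] using hp
  exact ⟨fun i => Function.extend e (fun p => c i p.1) fun _ => false, fun i j hij =>
    (hc i j hij).imp (fun h => (Nat.mul_le_mul_right k h).trans (key i j))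
      fun h => (Nat.mul_le_mul_right k h).trans (key j i)⟩

/-- The code whose positions are the `k`-subsets of the set of all `2 k` words. -/
lemma hasCode_centralBinom (k : ℕ) :
    HasCode (2 * (k + 1)) (k + 1).centralBinom k.centralBinom := by
  classical
  let ι := {s : Finset (Fin (2 * (k + 1))) // s ∈ Finset.univ.powersetCard (k + 1)}
  refine HasCode.of_fintype (ι := ι) (fun i s => decide (i ∈ s.1)) (fun i j hij => ?_) ?_
  · have hcard : ((Finset.univ \ {i, j}).powersetCard k).card = k.centralBinom := by
      rw [Finset.card_powersetCard, Finset.card_sdiff_of_subset (Finset.subset_univ _),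
        Finset.card_pair hij, Finset.card_univ, Fintype.card_fin, Nat.centralBinom]
      congr 1
    rw [← hcard]
    -- The positions separating `i` from `j` are the sets containing `i` but not `j`; removing `i`
    -- leaves an arbitrary `k`-subset of the other words.
    refine Finset.card_le_card_of_surjOn (fun s : ι => s.1.erase i) ?_
    intro s hs
    obtain ⟨h1, h2⟩ := Finset.mem_powersetCard.1 (Finset.mem_coe.1 hs)
    have hi : i ∉ s := fun h => by simpa using h1 h
    have hj : j ∉ s := fun h => by simpa using h1 h
    refine ⟨⟨insert i s, ?_⟩, ?_, Finset.erase_insert hi⟩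
    · rw [Finset.mem_powersetCard]
      exact ⟨Finset.subset_univ _, by rw [Finset.card_insert_of_notMem hi, h2]⟩
    · simp [hj, hij.symm]
  · rw [Fintype.card_coe, Finset.card_powersetCard, Finset.card_univ, Fintype.card_fin,
      Nat.centralBinom]

lemma hasCode_two : HasCode 2 1 1 := ⟨![![true], ![false]], by decide⟩

lemma hasCode_four : HasCode 4 2 1 :=
  ⟨![![true, true], ![true, false], ![false, true], ![false, false]], by decide⟩

lemma hasCode_five : HasCode 5 5 2 :=
  ⟨![![true, true, true, true, true], ![true, true, true, false, false],
    ![false, true, false, true, false], ![false, false, true, false, true],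
    ![false, false, false, false, false]], by decide⟩

lemma hasCode_six : HasCode 6 6 2 :=
  ⟨![![true, true, true, true, true, true], ![true, true, true, false, false, false],
    ![true, false, false, true, true, false], ![false, true, false, true, false, true],
    ![false, false, true, false, true, true],
    ![false, false, false, false, false, false]], by decide⟩

/-- The code of all pairs of five words, with the words of all ones and of all zeros. -/
lemma hasCode_seven : HasCode 7 10 3 :=
  ⟨![![true, true, true, true, true, true, true, true, true, true],
    ![true, true, true, true, false, false, false, false, false, false],
    ![true, false, false, false, true, true, true, false, false, false],
    ![false, true, false, false, true, false, false, true, true, false],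
    ![false, false, true, false, false, true, false, true, false, true],
    ![false, false, false, true, false, false, true, false, true, true],
    ![false, false, false, false, false, false, false, false, false, false]], by decide⟩

lemma pow_le_inv_of_le_two_thirds {w : ℝ} (h0 : 0 ≤ w) (h1 : w ≤ 2 / 3) {k : ℕ} (hk : 6 ≤ k) :
    w ^ k * (k + 3) ≤ 1 := by
  induction k, hk using Nat.le_induction with
  | base =>
    have := pow_le_pow_left₀ h0 h1 6
    norm_num at this ⊢
    linarith
  | succ k hk ih =>
    have hk' : (6 : ℝ) ≤ k := by exact_mod_cast hk
    have hp : 0 ≤ w ^ k := by positivity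
    have h2 : w * ((k : ℝ) + 1 + 3) ≤ k + 3 := by nlinarith
    push_cast
    rw [pow_succ]
    nlinarith [mul_le_mul_of_nonneg_left h2 hp]

/-- The codes needed for each size of the list after the first stage. -/
lemma exists_hasCode {w : ℝ} (h0 : 1 / 3 ≤ w) (h1 : w ≤ 2 / 3) {L : ℕ} (hL : 2 ≤ L) :
    ∃ N d : ℕ, 0 < N ∧ HasCode L N d ∧ N * (w ^ 3 + w ^ L) ≤ 4 * d * w ^ 3 := by
  have hw : 0 ≤ w := by linarith
  have hp : ∀ k, w ^ k ≤ (2 / 3) ^ k := fun k => pow_le_pow_left₀ hw h1 k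
  have hw3 : 0 ≤ w ^ 3 := by positivity
  have hmul : ∀ k, w ^ (3 + k) = w ^ 3 * w ^ k := fun k => pow_add _ _ _
  -- The goal says that `d / N` is at least `(1 + w ^ (L - 3)) / 4`. For the central binomial code
  -- `d / N = (k + 1) / (2 (2 k + 1))`, which gives the condition on `w ^ (L - 3)`. It can fail for
  -- `L` from five to seven, where special codes with the all-one and all-zero words do better.
  have general : ∀ k, L ≤ 2 * (k + 1) → 3 ≤ L → w ^ (L - 3) * (2 * k + 1) ≤ 1 →
      ∃ N d : ℕ, 0 < N ∧ HasCode L N d ∧ N * (w ^ 3 + w ^ L) ≤ 4 * d * w ^ 3 := by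
    intro k hk hL3 hle
    refine ⟨_, _, Nat.centralBinom_pos _, (hasCode_centralBinom k).mono hk, ?_⟩
    obtain ⟨m, rfl⟩ := Nat.exists_eq_add_of_le hL3
    rw [Nat.add_sub_cancel_left] at hle
    have hc : ((k : ℝ) + 1) * (k + 1).centralBinom = 2 * (2 * k + 1) * k.centralBinom := by
      exact_mod_cast Nat.succ_mul_centralBinom_succ k
    have hcpos : (0 : ℝ) < k.centralBinom := by exact_mod_cast Nat.centralBinom_pos k
    have hkpos : (0 : ℝ) < k + 1 := by positivity
    refine le_of_mul_le_mul_left ?_ hkpos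
    rw [hmul, ← mul_assoc, hc]
    have : (1 + w ^ m) * (2 * k + 1) ≤ 2 * (k + 1) := by linarith
    have h3 : 0 ≤ 2 * (k.centralBinom : ℝ) * w ^ 3 := by positivity
    nlinarith [mul_le_mul_of_nonneg_left this h3]
  rcases Nat.lt_or_ge L 9 with h | h
  · interval_cases L
    -- This case reads `w ^ 2 ≤ 3 w ^ 3`, the only use of `1 / 3 ≤ w` beyond positivity.
    · refine ⟨1, 1, one_pos, hasCode_two, ?_⟩
      push_cast
      nlinarith [sq_nonneg w]
    · refine ⟨2, 1, two_pos, hasCode_four.mono (by norm_num), ?_⟩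
      push_cast
      linarith
    · refine ⟨2, 1, two_pos, hasCode_four, ?_⟩
      push_cast
      have := hmul 1
      norm_num at this
      nlinarith
    · refine ⟨5, 2, by norm_num, hasCode_five, ?_⟩
      have := hmul 2
      norm_num at this ⊢
      have h2 := hp 2
      norm_num at h2
      nlinarith [mul_le_mul_of_nonneg_left h2 hw3]
    · refine ⟨6, 2, by norm_num, hasCode_six, ?_⟩
      have := hmul 3
      norm_num at this ⊢
      have h2 := hp 3
      norm_num at h2
      nlinarith [mul_le_mul_of_nonneg_left h2 hw3]
    · refine ⟨10, 3, by norm_num, hasCode_seven, ?_⟩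
      have := hmul 4
      norm_num at this ⊢
      have h2 := hp 4
      norm_num at h2
      nlinarith [mul_le_mul_of_nonneg_left h2 hw3]
    · refine general 3 (by norm_num) (by norm_num) ?_
      have h2 := hp 5
      norm_num at h2 ⊢
      linarith
  · obtain ⟨m, rfl⟩ := Nat.exists_eq_add_of_le h
    refine general ((m + 8) / 2) (by omega) (by omega) ?_
    have h2 := pow_le_inv_of_le_two_thirds hw h1 (k := m + 6) (by omega)
    have e : 9 + m - 3 = m + 6 := by omega
    rw [e]
    refine le_trans (mul_le_mul_of_nonneg_left ?_ (by positivity)) h2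
    have : 2 * ((m + 8) / 2) + 1 ≤ m + 6 + 3 := by omega
    exact_mod_cast this

/-! ### Achievability -/

/-- A first-stage code with small intersections, together with codes for the possible lists of
candidates after the first stage, gives a two-stage code. -/
lemma exists_corrects_of_codes {n₁ n₂ M t L₀ : ℕ} {w ε : ℝ} (hM : 0 < M) (hL₀ : 2 ≤ L₀)
    (c₁ : Fin M → Word n₁) (hw : ∀ m, (w - ε) * n₁ ≤ weight (c₁ m))
    (hint : ∀ S : Finset (Fin M), S.Nonempty → S.card ≤ L₀ → ∀ y : Word n₁,
      (∀ m ∈ S, CanReceive (c₁ m) y) → (weight y : ℝ) ≤ (w ^ S.card + ε) * n₁)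
    (hsmall : ∀ L, 2 ≤ L → L < L₀ →
      ∃ d, HasCode L n₂ d ∧ (t : ℝ) < (w - w ^ L - 2 * ε) * n₁ + d)
    (c₂ : Fin M → Word n₂)
    (hlarge : ∀ i j, i ≠ j →
      (t : ℝ) < (w - w ^ L₀ - 2 * ε) * n₁ + numErrors (c₂ i) (c₂ j)) :
    ∃ E : TwoStageEncoder n₁ n₂ M, E.Corrects t := by
  classical
  have herr : ∀ m (S : Finset (Fin M)), m ∈ S → S.card ≤ L₀ → ∀ y,
      (∀ m ∈ S, CanReceive (c₁ m) y) →
      (w - w ^ S.card - 2 * ε) * n₁ ≤ numErrors (c₁ m) y := by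
    intro m S hm hS y hy
    have h1 := hint S ⟨m, hm⟩ hS y hy
    have h2 : (numErrors (c₁ m) y : ℝ) + weight y = weight (c₁ m) := by
      exact_mod_cast numErrors_add_weight (hy m hm)
    linarith [hw m]
  have key : ∀ y : Word n₁, ∃ g : Fin M → Word n₂, ∀ m m', m ≠ m' → CanReceive (c₁ m) y →
      CanReceive (c₁ m') y → t < numErrors (c₁ m) y + numErrors (g m) (g m') ∨
        t < numErrors (c₁ m') y + numErrors (g m') (g m) := by
    intro y
    -- The list of messages still possible. Both sides know it from the feedback, so the
    -- second-stage code may depend on it.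
    set S : Finset (Fin M) := Finset.univ.filter fun m => CanReceive (c₁ m) y with hS
    have hmem : ∀ m, m ∈ S ↔ CanReceive (c₁ m) y := by simp [hS]
    rcases Nat.lt_or_ge S.card L₀ with hlt | hge
    · by_cases h2 : 2 ≤ S.card
      · obtain ⟨d, ⟨c, hc⟩, hd⟩ := hsmall _ h2 hlt
        refine ⟨fun m => if hm : m ∈ S then c (S.equivFin ⟨m, hm⟩) else fun _ => false, ?_⟩
        intro m m' hne h h'
        rw [← hmem] at h h'
        simp only [h, h', dif_pos]
        have hne' : S.equivFin ⟨m, h⟩ ≠ S.equivFin ⟨m', h'⟩ := by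
          simpa using hne
        have e1 := herr m S h hlt.le y fun m hm => (hmem m).1 hm
        have e2 := herr m' S h' hlt.le y fun m hm => (hmem m).1 hm
        refine (hc _ _ hne').imp (fun hh => ?_) (fun hh => ?_)
        · have hh' : (d : ℝ) ≤ _ := Nat.cast_le.2 hh
          have : (t : ℝ) < (numErrors (c₁ m) y : ℝ) + _ := hd.trans_le (add_le_add e1 hh')
          exact_mod_cast this
        · have hh' : (d : ℝ) ≤ _ := Nat.cast_le.2 hh
          have : (t : ℝ) < (numErrors (c₁ m') y : ℝ) + _ := hd.trans_le (add_le_add e2 hh')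
          exact_mod_cast this
      · refine ⟨fun _ _ => false, fun m m' hne h h' => absurd ?_ h2⟩
        exact Finset.one_lt_card.2 ⟨m, (hmem m).2 h, m', (hmem m').2 h', hne⟩
    · refine ⟨c₂, fun m m' hne h h' => Or.inl ?_⟩
      -- The intersection bound covers at most `L₀` words, so a long list is cut down to `L₀` of its
      -- members, keeping `m`.
      obtain ⟨S', hmS', hS'S, hcard⟩ := Finset.exists_subsuperset_card_eq
        (Finset.singleton_subset_iff.2 ((hmem m).2 h)) (by simp; omega) hge
      have e1 := herr m S' (Finset.singleton_subset_iff.1 hmS') hcard.le y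
        fun m hm => (hmem m).1 (hS'S hm)
      rw [hcard] at e1
      have : (t : ℝ) < (numErrors (c₁ m) y : ℝ) + numErrors (c₂ m) (c₂ m') :=
        (hlarge m m' hne).trans_le (add_le_add_left e1 _)
      exact_mod_cast this
  choose g hg using key
  exact ⟨⟨c₁, fun m y => g y m⟩, TwoStageEncoder.corrects_of_lt_or_lt hM _ fun m m' hne y h h' =>
    hg y m m' hne h h'⟩

/-- Codes for all short lists that are possible after a first stage of length `α n`, where `α`
balances the lists of three messages against the long lists. -/
lemma eventually_hasCode {w α ε : ℝ} (hw1 : 1 / 3 ≤ w) (hw2 : w ≤ 2 / 3) (hα0 : 0 < α)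
    (hβ : 1 - α = 4 * w ^ 3 * α) (hε0 : 0 < ε) (L₀ : ℕ) :
    ∀ᶠ n : ℕ in atTop, ∀ L ∈ Finset.Ico 2 L₀,
      ∃ d, HasCode L (n - ⌊α * n⌋₊) d ∧ (w ^ 3 + w ^ L) * α * n ≤ d + (6 * ε * n - 2) := by
  have hw0 : 0 < w := by linarith
  rw [Filter.eventually_all_finset]
  intro L hL
  obtain ⟨N, d, hN, hcode, hle⟩ := exists_hasCode hw1 hw2 (Finset.mem_Ico.1 hL).1
  obtain ⟨n₀, hn₀⟩ := exists_nat_ge ((d + 2) / (6 * ε))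
  filter_upwards [eventually_ge_atTop n₀] with n hn
  have hn' : (d + 2) / (6 * ε) ≤ n := hn₀.trans (by exact_mod_cast hn)
  rw [div_le_iff₀ (by positivity)] at hn'
  set n₂ := n - ⌊α * n⌋₊ with hn₂
  have hn₂' : 4 * w ^ 3 * α * n ≤ n₂ := by
    have h1 : (⌊α * n⌋₊ : ℝ) ≤ α * n := Nat.floor_le (by positivity)
    have h2 : (n : ℝ) ≤ n₂ + ⌊α * n⌋₊ := by exact_mod_cast (by omega : n ≤ n₂ + ⌊α * n⌋₊)
    rw [← hβ]
    linarith
  -- Rounding the number of repetitions down loses at most `d`. Together with a reserve of `2` for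
  -- later, this is at most `6 * ε * n`.
  refine ⟨d * (n₂ / N), hcode.repeat (Nat.mul_div_le _ _), ?_⟩
  have hN' : (0 : ℝ) < N := by exact_mod_cast hN
  have hk : (n₂ : ℝ) ≤ N * ((n₂ / N : ℕ) + 1) := by
    exact_mod_cast (Nat.lt_mul_div_succ n₂ hN).le
  have h3 : (w ^ 3 + w ^ L) * α * n ≤ d * ((n₂ / N : ℕ) + 1) := by
    have hw3 : 0 < 4 * w ^ 3 := by positivity
    refine le_of_mul_le_mul_left ?_ hw3
    calc 4 * w ^ 3 * ((w ^ 3 + w ^ L) * α * n) = (w ^ 3 + w ^ L) * (4 * w ^ 3 * α * n) := by ring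
      _ ≤ (w ^ 3 + w ^ L) * (N * ((n₂ / N : ℕ) + 1)) := by
          exact mul_le_mul_of_nonneg_left (hn₂'.trans hk) (by positivity)
      _ = N * (w ^ 3 + w ^ L) * ((n₂ / N : ℕ) + 1) := by ring
      _ ≤ 4 * d * w ^ 3 * ((n₂ / N : ℕ) + 1) := by gcongr
      _ = _ := by ring
  push_cast at h3 ⊢
  linarith

lemma exists_transmittable_exp {τ : ℝ} (hτ0 : 0 ≤ τ) (hτ : τ < tauMax) :
    ∃ δ : ℝ, 0 < δ ∧ ∀ᶠ n : ℕ in atTop, Transmittable n ⌊τ * n⌋₊ ⌊Real.exp (δ * n)⌋₊ := by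
  obtain ⟨w, hw1, hw2, hwt, -, -⟩ := exists_isGreatest_plotkinFun
  have hw0 : 0 < w := by linarith
  have hD := plotkinFun_pos_denom hw0.le
  have ht := plotkinFun_lt hw0.le
  rw [hwt] at ht
  set α : ℝ := 1 / (1 + 4 * w ^ 3) with hα
  have hα0 : 0 < α := by positivity
  have hβ : 1 - α = 4 * w ^ 3 * α := by rw [hα]; field_simp; ring
  have hβ0 : 0 < 1 - α := by rw [hβ]; positivity
  have hmax : tauMax = (w + w ^ 3) * α := by rw [← hwt, plotkinFun, hα]; ring
  -- For short lists, the eight parts are two for the deviations of the first-stage code and six for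
  -- rounding in the small codes.
  obtain ⟨ε, hε⟩ : ∃ ε, ε = (tauMax - τ) / 8 := ⟨_, rfl⟩
  have hε0 : 0 < ε := by rw [hε]; linarith
  have hε1 : ε ≤ 1 := by rw [hε]; linarith
  obtain ⟨L₀, hL₀, hwL⟩ : ∃ L₀ : ℕ, 2 ≤ L₀ ∧ w ^ L₀ ≤ ε := by
    obtain ⟨k, hk⟩ := exists_pow_lt_of_lt_one hε0 (by linarith : w < 1)
    exact ⟨k + 2, by omega, (pow_le_pow_of_le_one hw0.le (by linarith) (by omega)).trans hk.le⟩
  -- Half of the Chernoff exponent `ε ^ 2 / 4`, since `n₁` and `n₂` are only bounded below by half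
  -- of `α * n` and `(1 - α) * n`. Dividing further by `2 * L₀` makes room for `M + M ^ L₀` in the
  -- union bound.
  obtain ⟨c, hc⟩ : ∃ c, c = min α (1 - α) * (ε ^ 2 / 8) := ⟨_, rfl⟩
  have hc0 : 0 < c := by rw [hc]; have := lt_min hα0 hβ0; positivity
  have hL₀' : (2 : ℝ) ≤ L₀ := by exact_mod_cast hL₀
  refine ⟨c / (2 * L₀), by positivity, ?_⟩
  have hsmallcodes := eventually_hasCode hw1 hw2 hα0 hβ hε0 L₀
  obtain ⟨n₀, hn₀⟩ := exists_nat_ge (3 / α)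
  obtain ⟨n₀', hn₀'⟩ := exists_nat_ge (2 / c)
  obtain ⟨n₀'', hn₀''⟩ := exists_nat_ge (2 / ε)
  filter_upwards [hsmallcodes, eventually_ge_atTop n₀, eventually_ge_atTop n₀',
    eventually_ge_atTop n₀''] with n hcodes hn hn' hn''
  have hnα : 3 ≤ α * n := by
    have : 3 / α ≤ n := hn₀.trans (by exact_mod_cast hn)
    rwa [div_le_iff₀ hα0, mul_comm] at this
  have hnc : 2 ≤ c * n := by
    have : 2 / c ≤ n := hn₀'.trans (by exact_mod_cast hn')
    rwa [div_le_iff₀ hc0, mul_comm] at this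
  have hnε : 2 ≤ ε * n := by
    have : 2 / ε ≤ n := hn₀''.trans (by exact_mod_cast hn'')
    rwa [div_le_iff₀ hε0, mul_comm] at this
  have hn0 : (0 : ℝ) < n := pos_of_mul_pos_right (by linarith : 0 < α * n) hα0.le
  set n₁ := ⌊α * n⌋₊ with hn₁
  have h1 : (n₁ : ℝ) ≤ α * n := Nat.floor_le (by positivity)
  have h2 : α * n - 1 ≤ n₁ := by linarith [Nat.lt_floor_add_one (α * (n : ℝ))]
  have hle : n₁ ≤ n := by
    have : (n₁ : ℝ) ≤ n := h1.trans (mul_le_of_le_one_left hn0.le (by linarith))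
    exact_mod_cast this
  have h3 : (1 - α) * n ≤ (n - n₁ : ℕ) := by
    rw [Nat.cast_sub hle]
    linarith
  have h4 : ((n - n₁ : ℕ) : ℝ) ≤ n := by exact_mod_cast Nat.sub_le _ _
  set n₂ := n - n₁ with hn₂
  set M := ⌊Real.exp (c / (2 * L₀) * n)⌋₊ with hM
  have hM1 : 1 ≤ M := Nat.one_le_floor_iff _ |>.2 (Real.one_le_exp (by positivity))
  have hM1' : (1 : ℝ) ≤ M := by exact_mod_cast hM1
  have hMpow : (M : ℝ) ^ L₀ ≤ Real.exp (c * n / 2) := by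
    calc (M : ℝ) ^ L₀ ≤ Real.exp (c / (2 * L₀) * n) ^ L₀ := by
          gcongr
          exact Nat.floor_le (Real.exp_pos _).le
      _ = Real.exp (c * n / 2) := by
          rw [← Real.exp_nat_mul]
          congr 1
          field_simp
  have hdouble : 2 * Real.exp (c * n / 2) ≤ Real.exp (c * n) := by
    have : Real.exp (c * n) = Real.exp (c * n / 2) * Real.exp (c * n / 2) := by
      rw [← Real.exp_add]; congr 1; ring
    rw [this]
    gcongr
    linarith [Real.add_one_le_exp (c * n / 2)]
  have hexp1 : Real.exp (c * n) < Real.exp (ε ^ 2 / 4 * n₁) := by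
    refine Real.exp_lt_exp.2 ?_
    have : α * n / 2 < n₁ := by linarith
    calc c * n ≤ α * (ε ^ 2 / 8) * n := by rw [hc]; gcongr; exact min_le_left _ _
      _ = ε ^ 2 / 4 * (α * n / 2) := by ring
      _ < _ := by gcongr
  have hexp2 : Real.exp (c * n) < Real.exp (ε ^ 2 / 4 * n₂) := by
    refine Real.exp_lt_exp.2 ?_
    have : (1 - α) * n / 2 < n₂ := by
      have : 0 < (1 - α) * n := by positivity
      linarith
    calc c * n ≤ (1 - α) * (ε ^ 2 / 8) * n := by rw [hc]; gcongr; exact min_le_right _ _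
      _ = ε ^ 2 / 4 * ((1 - α) * n / 2) := by ring
      _ < _ := by gcongr
  have hMle : (M : ℝ) ≤ M ^ L₀ := le_self_pow₀ hM1' (by omega)
  have hMsq : (M : ℝ) ^ 2 ≤ M ^ L₀ := pow_le_pow_right₀ hM1' hL₀
  obtain ⟨c₁, hc₁, hint⟩ := exists_code_small_inter (M := M) (L := L₀) (n := n₁) hw0.le
    (by linarith) hε0 hε1 (by linarith)
  obtain ⟨c₂, hc₂⟩ := exists_code_quarter (M := M) (n := n₂) hε0 hε1
    (by linarith [Real.exp_pos (c * n / 2)])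
  have ht : (⌊τ * n⌋₊ : ℝ) ≤ (w + w ^ 3) * α * n - 8 * ε * n := by
    refine (Nat.floor_le (by positivity)).trans (le_of_eq ?_)
    rw [← hmax, hε]
    ring
  have hstage : ∀ L, (w - w ^ L) * α * n - 1 - 2 * ε * n ≤ (w - w ^ L - 2 * ε) * n₁ ∨ L = 0 := by
    intro L
    rcases Nat.eq_zero_or_pos L with rfl | hL
    · exact Or.inr rfl
    · left
      have hwL0 : 0 ≤ w ^ L := by positivity
      have hwL1 : w ^ L ≤ w := pow_le_of_le_one hw0.le (by linarith) hL.ne'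
      have e1 := mul_le_mul_of_nonneg_left h2 (sub_nonneg.2 hwL1)
      have e2 : (n₁ : ℝ) ≤ n := by exact_mod_cast hle
      have e3 := mul_le_mul_of_nonneg_left e2 (by positivity : 0 ≤ 2 * ε)
      linarith
  refine ⟨n₁, n₂, ?_, ?_, by omega, ?_⟩
  · have : (1 : ℝ) < n₁ := by linarith
    exact_mod_cast this
  · have : (0 : ℝ) < n₂ := lt_of_lt_of_le (by positivity) h3
    exact_mod_cast this
  · refine exists_corrects_of_codes (w := w) (ε := ε) hM1 hL₀ c₁ hc₁ hint ?_ c₂ ?_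
    · intro L hL2 hL
      obtain ⟨d, hd, hdle⟩ := hcodes L (Finset.mem_Ico.2 ⟨hL2, hL⟩)
      refine ⟨d, hd, ?_⟩
      have := (hstage L).resolve_right (by omega)
      linarith
    · intro i j hij
      have := (hstage L₀).resolve_right (by omega)
      have e1 := hc₂ i j hij
      have e2 : w ^ 3 * α * n ≤ n₂ / 4 := by
        rw [hβ] at h3
        linarith
      have e3 := mul_le_mul_of_nonneg_left h4 hε0.le
      have e4 : w ^ L₀ * (α * n) ≤ ε * n := by
        have : α * n ≤ n := mul_le_of_le_one_left hn0.le (by linarith)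
        gcongr
      linarith

lemma rate_pos {τ : ℝ} (hτ0 : 0 ≤ τ) (hτ : τ < tauMax) : 0 < rate τ := by
  obtain ⟨δ, hδ, htr⟩ := exists_transmittable_exp hτ0 hτ
  have hlog : 0 < Real.log 2 := Real.log_pos (by norm_num)
  have hlow : 0 < δ / Real.log 2 / 2 := by positivity
  refine hlow.trans_le ?_
  refine le_limsup_of_frequently_le (Eventually.frequently ?_) ?_
  · obtain ⟨n₀, hn₀⟩ := exists_nat_ge (2 * Real.log 2 / δ)
    filter_upwards [htr, eventually_ge_atTop n₀, eventually_ge_atTop 3] with n hn hnn hn3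
    have hn' : 2 * Real.log 2 / δ ≤ n := hn₀.trans (by exact_mod_cast hnn)
    rw [div_le_iff₀ hδ] at hn'
    have hnpos : (0 : ℝ) < n := by exact_mod_cast (by omega : 0 < n)
    -- The floor costs at most a factor of two because `maxMessages` is at least one; halving the
    -- rate absorbs this factor.
    have hle : Real.exp (δ * n) / 2 ≤ maxMessages n ⌊τ * n⌋₊ := by
      have h1 : ⌊Real.exp (δ * n)⌋₊ ≤ maxMessages n ⌊τ * n⌋₊ := (isGreatest_maxMessages hn3 _).2 hn
      have h2 : (⌊Real.exp (δ * n)⌋₊ : ℝ) ≤ maxMessages n ⌊τ * n⌋₊ := by exact_mod_cast h1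
      have h3 : (1 : ℝ) ≤ maxMessages n ⌊τ * n⌋₊ := by exact_mod_cast one_le_maxMessages hn3 _
      have h4 := Nat.lt_floor_add_one (Real.exp (δ * n))
      linarith
    have hl := Real.log_le_log (by positivity) hle
    rw [Real.log_div (Real.exp_pos _).ne' (by norm_num), Real.log_exp] at hl
    rw [le_div_iff₀ hnpos, Real.logb, le_div_iff₀ hlog]
    have : δ / Real.log 2 / 2 * n * Real.log 2 = δ * n / 2 := by field_simp
    rw [this]
    linarith
  · refine isBoundedUnder_of_eventually_le (a := 1) ?_
    filter_upwards [eventually_ge_atTop 3] with n hn3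
    have hnpos : (0 : ℝ) < n := by exact_mod_cast (by omega : 0 < n)
    rw [div_le_one hnpos, Real.logb_le_iff_le_rpow (by norm_num), Real.rpow_natCast]
    · exact_mod_cast (isGreatest_maxMessages hn3 _).1.le_two_pow
    · exact_mod_cast one_le_maxMessages hn3 _

end ZChannel

theorem mainTheorem1 :
    IsGreatest (ZChannel.plotkinFun '' Set.Ioo (0 : ℝ) 1) ZChannel.tauMax ∧
    |ZChannel.tauMax - 0.44| < 0.005 ∧
    (∀ τ : ℝ, 0 ≤ τ → τ < ZChannel.tauMax → 0 < ZChannel.rate τ) ∧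
    (∀ τ : ℝ, ZChannel.tauMax < τ → ZChannel.rate τ = 0) := by
  obtain ⟨w, hw, -, hwt, hg, -⟩ := ZChannel.exists_isGreatest_plotkinFun
  refine ⟨hg, ?_, fun _ => ZChannel.rate_pos, fun _ => ZChannel.rate_eq_zero⟩
  have h1 := ZChannel.plotkinFun_lt (ω := w) (by linarith)
  have h2 := ZChannel.tauMax_ge
  rw [hwt] at h1
  rw [abs_lt]
  constructor <;> norm_num at * <;> linarith
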